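/- All groups are abelian. A torsion-free group $G$ of finite rank is *almost completely decomposable* if it has a completely decomposable subgroup (a direct sum of torsion-free groups of rank $1$) of finite index. Its *regulator* $A=\mathrm{Reg}\,G$ is the intersection of all completely decomposable subgroups of least index; it is completely decomposable. Fix a decomposition of $A$ into a direct sum of groups of rank $1$. For a type $\tau$ let $A_\tau=\mathrm{Reg}_\tau G$ be the sum of the summands of type $\tau$ in this decomposition, and let $T=T(G)=\{\tau : A_\tau\neq 0\}$, so that $A=\bigoplus_{\tau\in T}A_\tau$. The group $G$ is *rigid* if the types in $T$ are pairwise non-comparable and each $A_\tau$ ($\tau\in T$) has rank $1$; it is *of ring type* if all types in $T$ are idempotent. Let $G$ be a rigid almost completely decomposable group of ring type whose regulator quotient $G/A$ is cyclic, say $G/A=\langle d+A\rangle$ with $d\in G$. The divisible hull of $G$ is $\tilde G=\bigoplus_{\tau\in T}\tilde A_\tau$, where $\tilde A_\tau$ is the divisible hull of $A_\tau$; let $\pi_\tau\colon\tilde G\to\tilde A_\tau$ be the projections. For $\tau\in T$ let $m_\tau$ be the order of $\pi_\tau(d)+A$ in the torsion group $\tilde G/A$, and let $R_\tau$ be the unital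 subring of $\mathbb{Q}$ whose additive group has type $\tau$. Put $T_0=\{\tau\in T : m_\tau>1\}$, let $1_{T_0}\in\prod_{\tau\in T}R_\tau$ be the element with components $1$ for $\tau\in T_0$ and $0$ for $\tau\in T\setminus T_0$, and let $$K_G=\mathbb{Z}\,1_{T_0}+\prod_{\tau\in T}m_\tau R_\tau ,$$ a unital subring of $\prod_{\tau\in T}R_\tau$ with group of units $K_G^*$. For $c=(c_\tau)_{\tau\in T}\in\prod_{\tau\in T}R_\tau$ and $x\in\tilde G$ put $cx=\sum_{\tau\in T}c_\tau\,\pi_\tau(x)$. **Lemma 2.3.** (1) If $f$ is an endomorphism (resp., an automorphism) of the group $G$, then there is an element $c\in K_G$ (resp., $c\in K_G^*$) such that $f(x)=cx$ for all $x\in G$. (2) If $c\in K_G$ (resp., $c\in K_G^*$), then there is an endomorphism (resp., an automorphism) $f\colon G\to G$ such that $f(x)=cx$ for all $x\in G$. -/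

import Mathlib

noncomputable section

namespace ACD

/-! ### Heights, characteristics, types -/

/-- The `p`-height of `x` in the abelian group `B`: the supremum of all `k` with `x ∈ p ^ k B`. -/
def height {B : Type*} [AddCommGroup B] (p : Nat.Primes) (x : B) : ℕ∞ :=
  ⨆ (k : ℕ) (_ : ∃ y : B, ((p : ℕ) ^ k) • y = x), (k : ℕ∞)

/-- A (possible) characteristic: a family of elements of `ℕ ∪ {∞}` indexed by the primes. -/
abbrev Characteristic := Nat.Primes → ℕ∞

/-- The characteristic `χ(x)` of an element of an abelian group. -/
def characteristic {B : Type*} [AddCommGroup B] (x : B) : Characteristic := fun p => height p x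

/-- Two characteristics are equivalent if they differ at finitely many primes only, and have the
value `∞` at the same primes. -/
instance typeSetoid : Setoid Characteristic where
  r χ ψ := {p | χ p ≠ ψ p}.Finite ∧ ∀ p, χ p = ⊤ ↔ ψ p = ⊤
  iseqv :=
    { refl := fun χ => by simp
      symm := fun {χ ψ} h => by
        refine ⟨?_, fun p => (h.2 p).symm⟩
        simpa only [ne_comm] using h.1
      trans := fun {χ ψ ω} h g => by
        refine ⟨(h.1.union g.1).subset ?_, fun p => (h.2 p).trans (g.2 p)⟩
        intro p hp
        by_contra hc
        simp only [Set.mem_union, Set.mem_ofPred_eq, not_or, not_not] at hc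
        exact hp (hc.1.trans hc.2) }

/-- A type is an equivalence class of characteristics. -/
def GroupType := Quotient typeSetoid

/-- The type of a characteristic. -/
def GroupType.mk (χ : Characteristic) : GroupType := Quotient.mk typeSetoid χ

/-- The pointwise order of characteristics induces the order of types. -/
instance : LE GroupType where
  le τ σ := ∃ χ ψ : Characteristic, GroupType.mk χ = τ ∧ GroupType.mk ψ = σ ∧ χ ≤ ψ

/-- A type is idempotent if it contains a characteristic with values in `{0, ∞}`. -/
def GroupType.IsIdempotent (τ : GroupType) : Prop :=
  ∃ χ : Characteristic, GroupType.mk χ = τ ∧ ∀ p, χ p = 0 ∨ χ p = ⊤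

/-- The type of an element of an abelian group. -/
def elemType {B : Type*} [AddCommGroup B] (x : B) : GroupType := GroupType.mk (characteristic x)

/-- Torsion-free groups of rank `1`. -/
def IsRankOne (B : Type*) [AddCommGroup B] : Prop :=
  IsAddTorsionFree B ∧ Module.rank ℤ B = 1

/-- `B` is a torsion-free group of rank `1` and of type `τ`, i.e. all its nonzero elements have
type `τ`. -/
def HasType (B : Type*) [AddCommGroup B] (τ : GroupType) : Prop :=
  IsRankOne B ∧ ∀ x : B, x ≠ 0 → elemType x = τ

/-! ### Almost completely decomposable groups and the regulator -/

/-- The family `B` of subgroups consists of torsion-free groups of rank `1`, and the subgroup `A`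
is the (internal) direct sum of this family. -/
structure IsRankOneDecomposition {G : Type*} [AddCommGroup G] {n : ℕ} (B : Fin n → AddSubgroup G)
    (A : AddSubgroup G) : Prop where
  rankOne : ∀ i, IsRankOne (B i)
  indep : iSupIndep B
  iSup_eq : ⨆ i, B i = A

/-- The subgroup `A` is a completely decomposable group of finite rank. -/
def IsCompletelyDecomposable {G : Type*} [AddCommGroup G] (A : AddSubgroup G) : Prop :=
  ∃ (n : ℕ) (B : Fin n → AddSubgroup G), IsRankOneDecomposition B A

/-- `G` is an almost completely decomposable group: a torsion-free group of finite rank with a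
completely decomposable subgroup of finite index. -/
class IsAlmostCompletelyDecomposable (G : Type*) [AddCommGroup G] : Prop where
  torsionFree : IsAddTorsionFree G
  finiteRank : Module.rank ℤ G < Cardinal.aleph0
  exists_subgroup : ∃ A : AddSubgroup G, IsCompletelyDecomposable A ∧ A.FiniteIndex

/-- `A` is a completely decomposable subgroup of (finite and) least index of `G`. -/
def IsLeastIndex {G : Type*} [AddCommGroup G] (A : AddSubgroup G) : Prop :=
  IsCompletelyDecomposable A ∧ A.FiniteIndex ∧
    ∀ A' : AddSubgroup G, IsCompletelyDecomposable A' → A'.FiniteIndex → A.index ≤ A'.index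

/-- The regulator `Reg G`: the intersection of all completely decomposable subgroups of least
index. -/
def regulator (G : Type*) [AddCommGroup G] : AddSubgroup G :=
  sInf {A | IsLeastIndex A}

/-- A direct decomposition of `Reg G` into torsion-free groups of rank `1`. -/
structure RegulatorDecomposition (G : Type*) [AddCommGroup G] where
  /-- the number of summands -/
  n : ℕ
  /-- the summands -/
  summand : Fin n → AddSubgroup G
  isDecomposition : IsRankOneDecomposition summand (regulator G)

/-! ### Helper facts -/

theorem le_height {B : Type*} [AddCommGroup B] {p : Nat.Primes} {x : B} {k : ℕ}
    (h : ∃ y : B, ((p : ℕ) ^ k) • y = x) : (k : ℕ∞) ≤ height p x :=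
  le_iSup₂_of_le k h le_rfl

theorem height_le_of_imp {B : Type*} [AddCommGroup B] {p : Nat.Primes} {x z : B}
    (h : ∀ k : ℕ, (∃ y : B, ((p : ℕ) ^ k) • y = x) → ∃ y : B, ((p : ℕ) ^ k) • y = z) :
    height p x ≤ height p z :=
  iSup₂_le fun k hk => le_height (h k hk)

theorem height_le_nsmul {B : Type*} [AddCommGroup B] (p : Nat.Primes) (n : ℕ) (x : B) :
    height p x ≤ height p (n • x) :=
  height_le_of_imp fun k ⟨y, hy⟩ => ⟨n • y, by rw [smul_comm, hy]⟩

theorem dvd_of_coprime {B : Type*} [AddCommGroup B] {q n : ℕ} (hq : Nat.Coprime q n) {x : B}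
    (h : ∃ y : B, q • y = n • x) : ∃ y : B, q • y = x := by
  obtain ⟨y, hy⟩ := h
  have e := Nat.gcd_eq_gcd_ab q n
  rw [hq.gcd_eq_one] at e
  refine ⟨(q.gcdA n) • x + (q.gcdB n) • y, ?_⟩
  have hy' : (q : ℤ) • y = (n : ℤ) • x := by simpa using hy
  rw [← natCast_zsmul, smul_add, smul_comm (q : ℤ) (q.gcdB n) y, hy', smul_smul, smul_smul,
    ← add_smul, mul_comm (q.gcdB n), ← e]
  simp

theorem height_nsmul_of_coprime {B : Type*} [AddCommGroup B] {p : Nat.Primes} {n : ℕ}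
    (hp : ¬ (p : ℕ) ∣ n) (x : B) : height p (n • x) = height p x :=
  le_antisymm
    (height_le_of_imp fun k hk =>
      dvd_of_coprime (((Nat.Prime.coprime_iff_not_dvd p.2).2 hp).pow_left k) hk)
    (height_le_nsmul p n x)

theorem height_le_of_nsmul_pow {B : Type*} [AddCommGroup B] [IsAddTorsionFree B] (p : Nat.Primes)
    (a : ℕ) (x : B) : height p (((p : ℕ) ^ a) • x) ≤ height p x + a := by
  refine iSup₂_le fun k ⟨y, hy⟩ => ?_
  rcases le_total k a with hka | hka
  · exact le_add_left (by exact_mod_cast hka)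
  · obtain ⟨j, rfl⟩ := Nat.exists_eq_add_of_le hka
    have : ((p : ℕ) ^ j) • y = x := by
      rw [pow_add, mul_smul] at hy
      exact nsmul_right_injective (pow_ne_zero a p.2.ne_zero) hy
    rw [add_comm a j]
    push_cast
    gcongr
    exact le_height ⟨y, this⟩

/-- In a torsion-free group nonzero multiples of an element have the type of this element. -/
theorem elemType_nsmul {B : Type*} [AddCommGroup B] [IsAddTorsionFree B] {n : ℕ} (hn : n ≠ 0)
    (x : B) : elemType (n • x) = elemType x := by
  refine Quotient.sound ⟨?_, fun p => ?_⟩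
  · have hf : {p : Nat.Primes | (p : ℕ) ∣ n}.Finite := by
      refine Set.Finite.of_finite_image (f := fun p : Nat.Primes => (p : ℕ)) ?_
        Subtype.val_injective.injOn
      refine (Set.finite_Iic n).subset ?_
      rintro _ ⟨p, hp, rfl⟩
      exact Nat.le_of_dvd (Nat.pos_of_ne_zero hn) hp
    refine hf.subset fun p hp => ?_
    by_contra hc
    exact hp (height_nsmul_of_coprime hc x)
  · constructor
    · intro h
      obtain ⟨a, m, hm, rfl⟩ := Nat.exists_eq_pow_mul_and_not_dvd hn p p.2.ne_one
      have h1 : height p (((p : ℕ) ^ a * m) • x) = ⊤ := h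
      have h2 := height_le_of_nsmul_pow p a (m • x)
      rw [smul_smul, h1, height_nsmul_of_coprime hm, top_le_iff, ENat.add_eq_top] at h2
      exact h2.resolve_right (ENat.natCast_ne_top a)
    · intro h
      have h1 : height p x = ⊤ := h
      exact top_le_iff.1 (h1 ▸ height_le_nsmul p n x)

theorem height_neg {B : Type*} [AddCommGroup B] (p : Nat.Primes) (x : B) :
    height p (-x) = height p x := by
  have key : ∀ z : B, height p z ≤ height p (-z) := fun z =>
    height_le_of_imp fun k ⟨y, hy⟩ => ⟨-y, by rw [smul_neg, hy]⟩
  exact le_antisymm (by simpa using key (-x)) (key x)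

theorem elemType_zsmul {B : Type*} [AddCommGroup B] [IsAddTorsionFree B] {n : ℤ} (hn : n ≠ 0)
    (x : B) : elemType (n • x) = elemType x := by
  obtain ⟨m, rfl | rfl⟩ := n.eq_nat_or_neg
  · rw [natCast_zsmul]
    exact elemType_nsmul (by simpa using hn) x
  · rw [neg_smul, natCast_zsmul, ← elemType_nsmul (n := m) (by simpa using hn) x]
    unfold elemType
    congr 1
    funext p
    exact height_neg p _

/-- A torsion-free group of rank `1` has a unique type. -/
theorem IsRankOne.existsUnique_hasType {B : Type*} [AddCommGroup B] (hB : IsRankOne B) :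
    ∃! τ, HasType B τ := by
  have := hB.1
  have hnt : Nontrivial B := by
    by_contra hc
    rw [not_nontrivial_iff_subsingleton] at hc
    have h1 := hB.2
    rw [rank_subsingleton'] at h1
    exact zero_ne_one h1
  obtain ⟨e, he⟩ := exists_ne (0 : B)
  refine ⟨elemType e, ⟨hB, fun x hx => ?_⟩, fun τ hτ => (hτ.2 e he).symm⟩
  have hdep : ¬ LinearIndependent ℤ ![e, x] := by
    intro hli
    have h2 := hli.cardinal_lift_le_rank
    rw [hB.2] at h2
    simp at h2
  rw [LinearIndependent.pair_iff] at hdep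
  push Not at hdep
  obtain ⟨s, t, hst, hne⟩ := hdep
  have hs : s ≠ 0 := by
    rintro rfl
    have ht := hne rfl
    rw [zero_smul, zero_add] at hst
    exact (smul_ne_zero ht hx) hst
  have ht : t ≠ 0 := by
    rintro rfl
    rw [zero_smul, add_zero] at hst
    exact (smul_ne_zero hs he) hst
  have hx' : t • x = (-s) • e := by
    rw [neg_smul]
    exact eq_neg_of_add_eq_zero_right hst
  rw [← elemType_zsmul ht x, hx', elemType_zsmul (neg_ne_zero.2 hs)]

/-- Some positive multiple of `G` lies in the regulator. -/
theorem exists_nsmul_mem_regulator (G : Type*) [AddCommGroup G]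
    [h : IsAlmostCompletelyDecomposable G] :
    ∃ k : ℕ, 0 < k ∧ ∀ g : G, k • g ∈ regulator G := by
  classical
  have hex : ∃ k : ℕ, ∃ A : AddSubgroup G, IsCompletelyDecomposable A ∧ A.FiniteIndex ∧
      A.index = k := by
    obtain ⟨A, hA, hf⟩ := h.exists_subgroup
    exact ⟨_, A, hA, hf, rfl⟩
  obtain ⟨A₀, hA₀, hf₀, hk₀⟩ := Nat.find_spec hex
  refine ⟨Nat.find hex, hk₀ ▸ Nat.pos_of_ne_zero hf₀.index_ne_zero, fun g => ?_⟩
  rw [regulator, AddSubgroup.mem_sInf]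
  rintro A ⟨hA, hf, hmin⟩
  have : A.index = Nat.find hex :=
    le_antisymm (hk₀ ▸ hmin A₀ hA₀ hf₀) (Nat.find_min' hex ⟨A, hA, hf, rfl⟩)
  rw [← this]
  exact A.nsmul_index_mem g

/-- The divisible hull of a subgroup of `G`, as a `ℚ`-subspace of the divisible hull of `G`. -/
def hull {G : Type*} [AddCommGroup G] (A : AddSubgroup G) : Submodule ℚ (DivisibleHull G) :=
  Submodule.span ℚ (DivisibleHull.coeAddMonoidHom G '' (A : Set G))

theorem coe_nsmul {G : Type*} [AddCommGroup G] (k : ℕ) (a : G) :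
    DivisibleHull.coeAddMonoidHom G (k • a) = (k : ℚ) • DivisibleHull.coeAddMonoidHom G a := by
  rw [map_nsmul]
  exact (Nat.cast_smul_eq_nsmul ℚ _ _).symm

theorem coe_zsmul {G : Type*} [AddCommGroup G] (k : ℤ) (a : G) :
    DivisibleHull.coeAddMonoidHom G (k • a) = (k : ℚ) • DivisibleHull.coeAddMonoidHom G a := by
  rw [map_zsmul]
  exact (Int.cast_smul_eq_zsmul ℚ _ _).symm

theorem mem_hull {G : Type*} [AddCommGroup G] {A : AddSubgroup G} {v : DivisibleHull G}
    (hv : v ∈ hull A) :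
    ∃ k : ℕ, 0 < k ∧ ∃ a ∈ A, (k : ℚ) • v = DivisibleHull.coeAddMonoidHom G a := by
  induction hv using Submodule.span_induction with
  | mem x hx =>
    obtain ⟨a, ha, rfl⟩ := hx
    exact ⟨1, one_pos, a, ha, by simp⟩
  | zero => exact ⟨1, one_pos, 0, A.zero_mem, by simp⟩
  | add x y _ _ hx hy =>
    obtain ⟨k, hk, a, ha, hka⟩ := hx
    obtain ⟨l, hl, b, hb, hlb⟩ := hy
    refine ⟨k * l, Nat.mul_pos hk hl, l • a + k • b,
      A.add_mem (A.nsmul_mem ha l) (A.nsmul_mem hb k), ?_⟩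
    rw [map_add, coe_nsmul, coe_nsmul, ← hka, ← hlb, smul_add, smul_smul, smul_smul]
    push_cast
    rw [mul_comm (l : ℚ) k]
  | smul q x _ hx =>
    obtain ⟨k, hk, a, ha, hka⟩ := hx
    refine ⟨q.den * k, Nat.mul_pos q.den_pos hk, q.num • a, A.zsmul_mem ha _, ?_⟩
    rw [coe_zsmul, ← hka, smul_smul, smul_smul]
    congr 1
    push_cast
    rw [mul_right_comm, Rat.den_mul_eq_num]

theorem iSupIndep_hull {G ι : Type*} [AddCommGroup G] [IsAddTorsionFree G]
    {A : ι → AddSubgroup G} (hA : iSupIndep A) : iSupIndep fun i => hull (A i) := by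
  classical
  rw [iSupIndep_iff_finsetSum_eq_zero_imp_eq_zero]
  intro s v hv hsum i hi
  have hv' : ∀ i : ι, ∃ k : ℕ, 0 < k ∧ (i ∈ s →
      ∃ a ∈ A i, (k : ℚ) • v i = DivisibleHull.coeAddMonoidHom G a) := by
    intro i
    by_cases h : i ∈ s
    · obtain ⟨k, hk, h'⟩ := mem_hull (hv i h)
      exact ⟨k, hk, fun _ => h'⟩
    · exact ⟨1, one_pos, fun h' => absurd h' h⟩
  choose k hk hka using hv'
  have hK : ∀ j ∈ s, ∃ a ∈ A j,
      ((∏ l ∈ s, k l : ℕ) : ℚ) • v j = DivisibleHull.coeAddMonoidHom G a := by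
    intro j hj
    obtain ⟨a, ha, e⟩ := hka j hj
    refine ⟨(∏ l ∈ s.erase j, k l) • a, (A j).nsmul_mem ha _, ?_⟩
    rw [coe_nsmul, ← e, smul_smul, ← Nat.cast_mul, Finset.prod_erase_mul _ _ hj]
  choose! a ha hae using hK
  have hinj : Function.Injective (DivisibleHull.coeAddMonoidHom G) :=
    DivisibleHull.coe_injective
  have hs0 : ∑ j ∈ s, a j = 0 := by
    apply hinj
    rw [map_sum, map_zero, ← Finset.sum_congr rfl hae, ← Finset.smul_sum, hsum, smul_zero]
  have hA' : iSupIndep fun i => AddSubgroup.toIntSubmodule (A i) :=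
    hA.map_orderIso AddSubgroup.toIntSubmodule
  have h0 := (iSupIndep_iff_finsetSum_eq_zero_imp_eq_zero _).1 hA' s a ha hs0 i hi
  have h1 := hae i hi
  rw [h0, map_zero] at h1
  refine (smul_eq_zero.1 h1).resolve_left ?_
  exact_mod_cast (Finset.prod_pos fun l _ => hk l).ne'

/-! ### Critical types, rigid groups, groups of ring type -/

namespace RegulatorDecomposition

variable {G : Type*} [AddCommGroup G] (D : RegulatorDecomposition G)

/-- `Reg_τ G`, the sum of the summands of type `τ` in the given decomposition of `Reg G`. -/
def component (τ : GroupType) : AddSubgroup G :=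
  ⨆ (i : Fin D.n) (_ : HasType (D.summand i) τ), D.summand i

/-- The set `T(G)` of critical types. -/
def criticalTypes : Set GroupType := {τ | D.component τ ≠ ⊥}

/-- The critical types are pairwise non-comparable. -/
def IsBlockRigid : Prop :=
  ∀ τ ∈ D.criticalTypes, ∀ σ ∈ D.criticalTypes, τ ≠ σ → ¬ τ ≤ σ ∧ ¬ σ ≤ τ

/-- `G` is block-rigid, and all the groups `Reg_τ G`, where `τ ∈ T(G)`, have rank `1`. -/
def IsRigid : Prop :=
  D.IsBlockRigid ∧ ∀ τ ∈ D.criticalTypes, Module.rank ℤ (D.component τ) = 1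

/-- All critical types are idempotent. -/
def IsOfRingType : Prop := ∀ τ ∈ D.criticalTypes, τ.IsIdempotent

theorem exists_hasType_of_mem {τ : GroupType} (h : τ ∈ D.criticalTypes) :
    ∃ i, HasType (D.summand i) τ := by
  by_contra hc
  push Not at hc
  exact h (by simp [component, hc])

instance : Finite D.criticalTypes := by
  choose f hf using fun τ : D.criticalTypes => D.exists_hasType_of_mem τ.2
  refine Finite.of_injective f fun τ σ h => Subtype.ext ?_
  exact (D.isDecomposition.rankOne (f τ)).existsUnique_hasType.unique (hf τ) (h ▸ hf σ)

instance : Fintype D.criticalTypes := Fintype.ofFinite _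

instance : DecidableEq D.criticalTypes := Classical.decEq _

theorem iSupIndep_component : iSupIndep D.component := by
  rw [iSupIndep_def]
  intro τ
  have key := D.isDecomposition.indep.disjoint_biSup_biSup'
    (s := {i | HasType (D.summand i) τ}) (t := {i | ¬ HasType (D.summand i) τ})
    (by rw [Set.disjoint_left]; exact fun i hi hi' => hi' hi) (Set.toFinite _)
  refine key.mono le_rfl ?_
  refine iSup₂_le fun σ hσ => iSup₂_le fun i hi => ?_
  refine le_iSup₂_of_le i ?_ le_rfl
  exact fun hi' => hσ
    ((D.isDecomposition.rankOne i).existsUnique_hasType.unique hi hi')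

theorem iSup_component : ⨆ τ : D.criticalTypes, D.component τ = regulator G := by
  refine le_antisymm (iSup_le fun τ => iSup₂_le fun i _ => ?_) ?_
  · rw [← D.isDecomposition.iSup_eq]
    exact le_iSup D.summand i
  · rw [← D.isDecomposition.iSup_eq]
    refine iSup_le fun i => ?_
    obtain ⟨τ, hτ, -⟩ := (D.isDecomposition.rankOne i).existsUnique_hasType
    have hle : D.summand i ≤ D.component τ := le_iSup₂_of_le i hτ le_rfl
    by_cases h : D.component τ = ⊥
    · exact hle.trans (h ▸ bot_le)
    · exact hle.trans (le_iSup (fun σ : D.criticalTypes => D.component σ) ⟨τ, h⟩)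

/-! ### The divisible hull -/

variable [IsAlmostCompletelyDecomposable G]

/-- The divisible hull of `G` is the direct sum of the divisible hulls of the `Reg_τ G`. -/
theorem isInternal_hull :
    DirectSum.IsInternal fun τ : D.criticalTypes => hull (D.component τ) := by
  have : IsAddTorsionFree G := IsAlmostCompletelyDecomposable.torsionFree
  refine DirectSum.isInternal_submodule_of_iSupIndep_of_iSup_eq_top ?_ ?_
  · exact iSupIndep_hull (D.iSupIndep_component.comp Subtype.val_injective)
  · rw [eq_top_iff]
    rintro v -
    have hreg : ∀ a ∈ regulator G, DivisibleHull.coeAddMonoidHom G a ∈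
        ⨆ τ : D.criticalTypes, hull (D.component τ) := by
      have hle : regulator G ≤ AddSubgroup.comap (DivisibleHull.coeAddMonoidHom G)
          (⨆ τ : D.criticalTypes, hull (D.component τ)).toAddSubgroup := by
        rw [← D.iSup_component]
        refine iSup_le fun τ a ha => ?_
        exact Submodule.mem_iSup_of_mem τ (Submodule.subset_span ⟨a, ha, rfl⟩)
      exact fun a ha => hle ha
    obtain ⟨k, hk, hkG⟩ := exists_nsmul_mem_regulator G
    induction v with
    | mk g s =>
      have e : DivisibleHull.mk g s =
          ((k * (s : ℕ) : ℕ) : ℚ)⁻¹ • DivisibleHull.coeAddMonoidHom G (k • g) := by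
        have hne : ((k * (s : ℕ) : ℕ) : ℚ) ≠ 0 := by
          exact_mod_cast (Nat.mul_pos hk s.pos).ne'
        rw [eq_inv_smul_iff₀ hne, DivisibleHull.qsmul_mk,
          DivisibleHull.coeAddMonoidHom_apply, DivisibleHull.mk_eq_mk]
        refine ⟨1, ?_⟩
        simp only [Rat.num_natCast, Rat.den_natCast, natCast_zsmul, smul_smul]
        simp [mul_comm]
      rw [e]
      exact Submodule.smul_mem _ _ (hreg _ (hkG g))

theorem bijective_hull : Function.Bijective
    (DirectSum.coeLinearMap fun τ : D.criticalTypes => hull (D.component τ)) :=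
  D.isInternal_hull

/-- The projection `π_τ` of the divisible hull of `G` onto the divisible hull of `Reg_τ G`. -/
def proj (τ : D.criticalTypes) : DivisibleHull G →ₗ[ℚ] DivisibleHull G :=
  (hull (D.component τ)).subtype ∘ₗ
    DirectSum.component ℚ D.criticalTypes (fun σ => hull (D.component σ)) τ ∘ₗ
      (LinearEquiv.ofBijective (DirectSum.coeLinearMap fun σ : D.criticalTypes =>
        hull (D.component σ)) D.bijective_hull).symm.toLinearMap

theorem proj_of_mem {τ : D.criticalTypes} {v : DivisibleHull G} (hv : v ∈ hull (D.component τ))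
    (σ : D.criticalTypes) : D.proj σ v = if σ = τ then v else 0 := by
  have key : (LinearEquiv.ofBijective (DirectSum.coeLinearMap fun σ : D.criticalTypes =>
        hull (D.component σ)) D.bijective_hull).symm v
      = DirectSum.lof ℚ D.criticalTypes (fun σ => hull (D.component σ)) τ ⟨v, hv⟩ := by
    rw [LinearEquiv.symm_apply_eq, LinearEquiv.ofBijective_apply, DirectSum.coeLinearMap_lof]
  unfold proj
  rw [LinearMap.comp_apply, LinearMap.comp_apply, LinearEquiv.coe_coe, key]
  by_cases h : σ = τ
  · subst h
    rw [DirectSum.component.lof_self, if_pos rfl]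
    rfl
  · rw [DirectSum.component.of, dif_neg (Ne.symm h), if_neg h, map_zero]

/-- The order `m_τ` of the coset of `d_τ = π_τ(d)` modulo `Reg G` in the quotient of the divisible
hull by `Reg G`. -/
def m (d : G) (τ : D.criticalTypes) : ℕ :=
  addOrderOf (QuotientAddGroup.mk (D.proj τ (d : DivisibleHull G)) :
    DivisibleHull G ⧸ (regulator G).map (DivisibleHull.coeAddMonoidHom G))

/-- Multiplication by a family of rational numbers: the element `x = ∑ x_τ` of the divisible hull,
where `x_τ = π_τ(x)`, is sent to `∑ c_τ x_τ`. -/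
def mulBy (c : D.criticalTypes → ℚ) (x : DivisibleHull G) : DivisibleHull G :=
  ∑ τ, c τ • D.proj τ x

end RegulatorDecomposition

/-! ### The ring `K_G` -/

/-- The family `1_{T₀}`, where `T₀` is the set of all `τ ∈ T` with `m_τ > 1`: its `τ`-th member is
`1` if `τ ∈ T₀`, and `0` otherwise. (The numbers `m_τ` are positive, so that `m_τ > 1` means
`m_τ ≠ 1`.) -/
def oneT₀ {T : Type*} (R : T → Subring ℚ) (m : T → ℕ) : ∀ τ, R τ :=
  fun τ => if m τ = 1 then 0 else 1

/-- For subrings `R_τ` of `ℚ` and positive integers `m_τ` (`τ ∈ T`), the subring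
`ℤ 1_{T₀} + ∏ m_τ R_τ` of the ring `∏ R_τ`. -/
def kRing {T : Type*} (R : T → Subring ℚ) (m : T → ℕ) : Subring (∀ τ, R τ) where
  carrier := {c | ∃ (γ : ℤ) (y : ∀ τ, R τ), c = γ • oneT₀ R m + fun τ => m τ • y τ}
  one_mem' := by
    refine ⟨1, fun τ => if m τ = 1 then 1 else 0, ?_⟩
    funext τ
    by_cases h : m τ = 1 <;> simp [oneT₀, h]
  mul_mem' := by
    rintro _ _ ⟨γ, y, rfl⟩ ⟨δ, z, rfl⟩
    refine ⟨γ * δ, fun τ => γ • (oneT₀ R m τ * z τ) + δ • (y τ * oneT₀ R m τ)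
      + m τ • (y τ * z τ), ?_⟩
    funext τ
    by_cases h : m τ = 1
    · simp [oneT₀, h]
    · simp only [oneT₀, h, if_false, Pi.mul_apply, Pi.add_apply, Pi.intCast_apply,
        zsmul_eq_mul, nsmul_eq_mul]
      push_cast
      ring
  zero_mem' := ⟨0, 0, by funext τ; simp⟩
  add_mem' := by
    rintro _ _ ⟨γ, y, rfl⟩ ⟨δ, z, rfl⟩
    refine ⟨γ + δ, y + z, ?_⟩
    funext τ
    simp only [Pi.add_apply, Pi.smul_apply, add_smul, smul_add]
    abel
  neg_mem' := by
    rintro _ ⟨γ, y, rfl⟩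
    refine ⟨-γ, -y, ?_⟩
    funext τ
    simp only [Pi.add_apply, Pi.smul_apply, Pi.neg_apply, neg_smul, smul_neg]
    abel

end ACD

end

namespace ACD

/-! ### Divisibility and types -/

/-! Two facts carry the proof. First, since critical types are pairwise non-comparable, there is no
nonzero homomorphism between distinct `Reg_τ G` (`IsRigid.hom_eq_zero`). Second, each `Reg_τ G` is
pure in `G` (`IsRigid.mem_component_iff`): the sum of the purifications is itself completely
decomposable and contains every completely decomposable subgroup of finite index, so it is the only
one of least index and equals the regulator.

Hence an endomorphism `f` preserves each rank one group `Reg_τ G` and acts there as a rational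
number `c_τ`, which lies in `R_τ` because multiplication by `c_τ` preserves a group of type `τ`
(`IsRigid.mem_subring_iff`). Write `d_τ = π_τ(d)`. As `d` generates `G` modulo the regulator, `f d -
γ d` lies in the regulator for some integer `γ`. Projecting, `(c_τ - γ) d_τ ∈ Reg_τ G` for all `τ`,
which by the definition of `m_τ` means `c_τ - γ ∈ m_τ R_τ`. One `γ` serves all `τ`, and this is
membership in `K_G`.

Conversely, if `c_τ - γ = m_τ y_τ`, then `c d = γ d + ∑ y_τ (m_τ d_τ)` lies in `G`, since `m_τ d_τ ∈
Reg_τ G`; so multiplication by `c` preserves `G`. Automorphisms correspond to units because `c` is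
determined by its action. -/

theorem height_eq_top_of_divisible {B : Type*} [AddCommGroup B] {p : Nat.Primes}
    (h : ∀ b : B, ∃ y : B, (p : ℕ) • y = b) (x : B) : height p x = ⊤ := by
  have key : ∀ k : ℕ, ∃ y : B, ((p : ℕ) ^ k) • y = x := by
    intro k
    induction k with
    | zero => exact ⟨x, by simp⟩
    | succ k ih =>
      obtain ⟨y, hy⟩ := ih
      obtain ⟨z, rfl⟩ := h y
      exact ⟨z, by rw [pow_succ, mul_smul, hy]⟩
  exact ENat.eq_top_iff_forall_ge.2 fun k => le_height (key k)

theorem exists_smul_eq_of_height_eq_top {B : Type*} [AddCommGroup B] {p : Nat.Primes} {x : B}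
    (h : height p x = ⊤) : ∃ y : B, (p : ℕ) • y = x := by
  by_contra hc
  have h0 : height p x ≤ (0 : ℕ∞) := by
    refine iSup₂_le fun k ⟨y, hy⟩ => ?_
    rcases k with _ | k
    · simp
    · exact absurd ⟨((p : ℕ) ^ k) • y, by rw [smul_smul, ← pow_succ', hy]⟩ hc
  rw [h] at h0
  simp at h0

theorem IsRankOne.nontrivial {B : Type*} [AddCommGroup B] (hB : IsRankOne B) : Nontrivial B := by
  by_contra hc
  rw [not_nontrivial_iff_subsingleton] at hc
  have h1 := hB.2
  rw [rank_subsingleton'] at h1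
  exact zero_ne_one h1

theorem IsRankOne.exists_zsmul_eq {B : Type*} [AddCommGroup B] (hB : IsRankOne B) {e : B}
    (he : e ≠ 0) (x : B) : ∃ s t : ℤ, s ≠ 0 ∧ s • x = t • e := by
  have := hB.1
  have hdep : ¬ LinearIndependent ℤ ![e, x] := by
    intro hli
    have h2 := hli.cardinal_lift_le_rank
    rw [hB.2] at h2
    simp at h2
  rw [LinearIndependent.pair_iff] at hdep
  push Not at hdep
  obtain ⟨s, t, hst, hne⟩ := hdep
  refine ⟨t, -s, ?_, ?_⟩
  · rintro rfl
    rw [zero_smul, add_zero] at hst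
    exact hne ((smul_eq_zero.1 hst).resolve_right he) rfl
  · rw [neg_smul]
    exact eq_neg_of_add_eq_zero_right hst

/-- A homomorphism from a group of rank `1` to a torsion-free group that vanishes at a nonzero
element is zero. -/
theorem IsRankOne.eq_zero_of_apply_eq_zero {B C : Type*} [AddCommGroup B] [AddCommGroup C]
    [IsAddTorsionFree C] (hB : IsRankOne B) (f : B →+ C) {e : B} (he : e ≠ 0) (hf : f e = 0)
    (x : B) : f x = 0 := by
  obtain ⟨s, t, hs, h⟩ := hB.exists_zsmul_eq he x
  have h' := congrArg f h
  rw [map_zsmul, map_zsmul, hf, smul_zero] at h'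
  exact (smul_eq_zero.1 h').resolve_left hs

/-- Divisibility by `p` forces infinite `p`-height everywhere, and equivalent characteristics are
infinite at the same primes. -/
theorem HasType.prime_divisible_congr {B C : Type*} [AddCommGroup B] [AddCommGroup C]
    {τ : GroupType} (hB : HasType B τ) (hC : HasType C τ) (p : Nat.Primes)
    (h : ∀ b : B, ∃ y : B, (p : ℕ) • y = b) (c : C) : ∃ y : C, (p : ℕ) • y = c := by
  by_cases hc : c = 0
  · exact ⟨0, by simp [hc]⟩
  have := hB.1.nontrivial
  obtain ⟨b, hb⟩ := exists_ne (0 : B)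
  have e : elemType b = elemType c := (hB.2 b hb).trans (hC.2 c hc).symm
  exact exists_smul_eq_of_height_eq_top
    (((Quotient.exact e).2 p).1 (height_eq_top_of_divisible h b))

/-- Divisibility by a positive integer depends on the type only. -/
theorem HasType.divisible_congr {B C : Type*} [AddCommGroup B] [AddCommGroup C]
    {τ : GroupType} (hB : HasType B τ) (hC : HasType C τ) {n : ℕ} (hn : n ≠ 0)
    (h : ∀ b : B, ∃ y : B, n • y = b) (c : C) : ∃ y : C, n • y = c := by
  -- Divisibility by `p * a` implies divisibility by `p` and by `a` separately; each factor is
  -- transferred to `C` and the two are composed there.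
  induction n using induction_on_primes generalizing c with
  | zero => exact absurd rfl hn
  | one => exact ⟨c, by simp⟩
  | prime_mul p a hp ih =>
    obtain ⟨y, rfl⟩ := ih (right_ne_zero_of_mul hn)
      (fun b => (h b).imp' (fun y => p • y) fun y hy => by rw [smul_smul, mul_comm, hy]) c
    obtain ⟨z, rfl⟩ := hB.prime_divisible_congr hC ⟨p, hp⟩
      (fun b => (h b).imp' (fun y => a • y) fun y hy => by rw [smul_smul, hy]) y
    exact ⟨z, by rw [smul_smul, mul_comm]⟩

/-! ### Subrings of `ℚ` and homomorphisms in terms of types -/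

/-- Dividing a Bézout identity `u * num + v * den = 1` by `den` gives `1 / den = c * u + v`. -/
theorem Subring.inv_den_mem (R : Subring ℚ) {c : ℚ} (hc : c ∈ R) : (c.den : ℚ)⁻¹ ∈ R := by
  have e := Int.gcd_eq_gcd_ab c.num c.den
  have hg : Int.gcd c.num c.den = 1 := c.reduced
  rw [hg] at e
  have h0 : (c.den : ℚ) ≠ 0 := by exact_mod_cast c.den_ne_zero
  have key : (c.den : ℚ)⁻¹ = c * (Int.gcdA c.num c.den : ℤ) + (Int.gcdB c.num c.den : ℤ) := by
    rw [inv_eq_iff_eq_inv, ← one_div, eq_div_iff_mul_eq ?_]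
    · nth_rewrite 2 [← Rat.num_div_den c]
      have e' : (1 : ℚ) = c.num * (Int.gcdA c.num c.den) + c.den * (Int.gcdB c.num c.den) := by
        exact_mod_cast e
      field_simp
      linarith
    · intro h
      nth_rewrite 1 [← Rat.num_div_den c] at h
      have e' : (1 : ℚ) = c.num * (Int.gcdA c.num c.den) + c.den * (Int.gcdB c.num c.den) := by
        exact_mod_cast e
      field_simp at h
      linarith
  rw [key]
  exact R.add_mem (R.mul_mem hc (intCast_mem R _)) (intCast_mem R _)

/-- The subring of `ℚ` of type `τ` consists of those rational numbers whose denominators divide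
all elements of a given group of type `τ`. -/
theorem HasType.mem_subring_iff {B : Type*} [AddCommGroup B] {τ : GroupType} (hB : HasType B τ)
    {R : Subring ℚ} (hR : HasType R τ) (c : ℚ) :
    c ∈ R ↔ ∀ b : B, ∃ y : B, c.den • y = b := by
  have h0 : (c.den : ℚ) ≠ 0 := by exact_mod_cast c.den_ne_zero
  constructor
  · intro hc
    refine hR.divisible_congr hB c.den_ne_zero fun r => ?_
    refine ⟨⟨(c.den : ℚ)⁻¹, Subring.inv_den_mem R hc⟩ * r, Subtype.ext ?_⟩
    simp [h0]
  · intro h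
    obtain ⟨y, hy⟩ := hB.divisible_congr hR c.den_ne_zero h 1
    have hy' : (c.den : ℚ) * (y : ℚ) = 1 := by
      have := congrArg Subtype.val hy
      simpa using this
    have : c = c.num * (y : ℚ) := by
      rw [eq_inv_of_mul_eq_one_right hy', ← div_eq_mul_inv, Rat.num_div_den]
    rw [this]
    exact R.mul_mem (intCast_mem R _) y.2

/-- Homomorphisms do not decrease heights. -/
theorem HasType.le_of_hom {B C : Type*} [AddCommGroup B] [AddCommGroup C] {τ σ : GroupType}
    (hB : HasType B τ) (hC : HasType C σ) (f : B →+ C) {x : B} (hx : f x ≠ 0) : τ ≤ σ := by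
  have hx0 : x ≠ 0 := by
    rintro rfl
    exact hx (map_zero f)
  refine ⟨characteristic x, characteristic (f x), hB.2 x hx0, hC.2 _ hx, fun p => ?_⟩
  refine iSup₂_le fun k ⟨y, hy⟩ => le_height ⟨f y, by rw [← map_nsmul, hy]⟩

theorem exists_sub_zsmul_mem {G : Type*} [AddCommGroup G] {d : G}
    (hd : AddSubgroup.zmultiples (d : G ⧸ regulator G) = ⊤) (x : G) : ∃ γ : ℤ, x - γ • d ∈ regulator G := by
  have hx : (x : G ⧸ regulator G) ∈ AddSubgroup.zmultiples (d : G ⧸ regulator G) := by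
    rw [hd]; trivial
  obtain ⟨γ, hγ⟩ := hx
  refine ⟨γ, ?_⟩
  rw [← QuotientAddGroup.eq_zero_iff, QuotientAddGroup.mk_sub, QuotientAddGroup.mk_zsmul,
    sub_eq_zero]
  exact hγ.symm

/-! ### Coordinates -/

/-- The coordinate homomorphisms of a finite direct sum of subgroups. -/
theorem exists_coordinates {G ι : Type*} [AddCommGroup G] [Fintype ι] {B : ι → AddSubgroup G}
    (hB : iSupIndep B) {A : AddSubgroup G} (hA : ⨆ i, B i = A) :
    ∃ π : ∀ i, A →+ B i, ∀ x : A, ∑ i, (π i x : G) = x := by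
  classical
  let φ : (∀ i, B i) →+ G :=
    { toFun := fun v => ∑ i, (v i : G)
      map_zero' := by simp
      map_add' := fun v w => by simp [Finset.sum_add_distrib] }
  have hφ : ∀ v, φ v = ∑ i, (v i : G) := fun _ => rfl
  have hinj : Function.Injective φ := by
    rw [injective_iff_map_eq_zero]
    intro v hv
    have hB' : iSupIndep fun i => AddSubgroup.toIntSubmodule (B i) :=
      hB.map_orderIso AddSubgroup.toIntSubmodule
    funext i
    exact Subtype.ext ((iSupIndep_iff_finsetSum_eq_zero_imp_eq_zero _).1 hB' Finset.univ
      (fun i => (v i : G)) (fun i _ => (v i).2) hv i (Finset.mem_univ i))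
  have hrange : A ≤ φ.range := by
    rw [← hA]
    refine iSup_le fun i b hb => ⟨Pi.single i ⟨b, hb⟩, ?_⟩
    rw [hφ, Finset.sum_eq_single i]
    · simp
    · intro j _ hj
      simp [hj]
    · simp
  let e := AddMonoidHom.ofInjective hinj
  refine ⟨fun i => (Pi.evalAddMonoidHom (fun i => B i) i).comp
    (e.symm.toAddMonoidHom.comp (AddSubgroup.inclusion hrange)), fun x => ?_⟩
  have h := congrArg Subtype.val (e.apply_symm_apply (AddSubgroup.inclusion hrange x))
  exact h

namespace RegulatorDecomposition

variable {G : Type*} [AddCommGroup G] (D : RegulatorDecomposition G)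

/-! ### The components of a rigid group -/

/-- Two different summands of type `τ` would supply a linearly independent pair in a group of rank
`1`, so the component is a single summand. -/
theorem hasType_component {τ : GroupType} (hτ : τ ∈ D.criticalTypes)
    (h1 : Module.rank ℤ (D.component τ) = 1) : HasType (D.component τ) τ := by
  obtain ⟨i, hi⟩ := D.exists_hasType_of_mem hτ
  have hle : ∀ j, HasType (D.summand j) τ → D.summand j ≤ D.component τ :=
    fun j hj => le_iSup₂_of_le j hj le_rfl
  suffices h : D.component τ = D.summand i by rw [h]; exact hi
  refine le_antisymm (iSup₂_le fun j hj => ?_) (hle i hi)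
  by_contra hc
  have hji : j ≠ i := by
    rintro rfl
    exact hc le_rfl
  have htf := hj.1.1
  have hdis : Disjoint (D.summand j) (D.summand i) := D.isDecomposition.indep.pairwiseDisjoint hji
  have := hi.1.nontrivial
  have := hj.1.nontrivial
  obtain ⟨x, hx⟩ := exists_ne (0 : D.summand i)
  obtain ⟨y, hy⟩ := exists_ne (0 : D.summand j)
  have hli : LinearIndependent ℤ
      ![AddSubgroup.inclusion (hle i hi) x, AddSubgroup.inclusion (hle j hj) y] := by
    rw [LinearIndependent.pair_iff]
    intro s t hst
    have hst' : s • (x : G) + t • (y : G) = 0 := congrArg Subtype.val hst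
    have h0 : t • (y : G) = 0 := by
      refine (AddSubgroup.disjoint_def.1 hdis) ((D.summand j).zsmul_mem y.2 t) ?_
      rw [← neg_eq_of_add_eq_zero_right hst']
      exact (D.summand i).neg_mem ((D.summand i).zsmul_mem x.2 s)
    have h0' : s • (x : G) = 0 := by rwa [h0, add_zero] at hst'
    have := hi.1.1
    exact ⟨(smul_eq_zero.1 (Subtype.ext h0' : s • x = 0)).resolve_right hx,
      (smul_eq_zero.1 (Subtype.ext h0 : t • y = 0)).resolve_right hy⟩
  have h2 := hli.cardinal_lift_le_rank
  rw [h1] at h2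
  simp at h2

variable {D}

theorem IsRigid.hasType (h : D.IsRigid) (τ : D.criticalTypes) : HasType (D.component τ) τ :=
  D.hasType_component τ.2 (h.2 τ τ.2)

theorem IsRigid.exists_ne_zero (h : D.IsRigid) (τ : D.criticalTypes) :
    ∃ a ∈ D.component τ, a ≠ 0 := by
  have := (h.hasType τ).1.nontrivial
  obtain ⟨a, ha⟩ := exists_ne (0 : D.component τ)
  exact ⟨a, a.2, fun e => ha (Subtype.ext e)⟩

theorem IsRigid.hom_eq_zero (h : D.IsRigid) {τ σ : D.criticalTypes} (hne : τ ≠ σ)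
    (f : D.component τ →+ D.component σ) (x : D.component τ) : f x = 0 := by
  by_contra hx
  exact (h.1 τ τ.2 σ σ.2 (fun e => hne (Subtype.ext e))).1
    ((h.hasType τ).le_of_hom (h.hasType σ) f hx)

variable (D)

theorem component_le_regulator (τ : D.criticalTypes) : D.component τ ≤ regulator G :=
  D.iSup_component ▸ le_iSup (fun σ : D.criticalTypes => D.component σ) τ

theorem exists_component_coordinates :
    ∃ π : ∀ τ : D.criticalTypes, regulator G →+ D.component τ,
      ∀ x : regulator G, ∑ τ, (π τ x : G) = x :=
  exists_coordinates (D.iSupIndep_component.comp Subtype.val_injective) D.iSup_component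

/-- The purification of `Reg_τ G` in `G`. -/
noncomputable def purification (τ : D.criticalTypes) : AddSubgroup G :=
  (hull (D.component τ)).toAddSubgroup.comap (DivisibleHull.coeAddMonoidHom G)

theorem mem_purification {τ : D.criticalTypes} {x : G} :
    x ∈ D.purification τ ↔ (x : DivisibleHull G) ∈ hull (D.component τ) := Iff.rfl

theorem mem_purification_of_mem {τ : D.criticalTypes} {x : G} (hx : x ∈ D.component τ) :
    x ∈ D.purification τ := Submodule.subset_span ⟨x, hx, rfl⟩

theorem mem_purification_of_nsmul_mem {τ : D.criticalTypes} {x : G} {k : ℕ} (hk : k ≠ 0)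
    (hx : k • x ∈ D.component τ) : x ∈ D.purification τ := by
  have h := D.mem_purification_of_mem hx
  rw [mem_purification] at h ⊢
  have e : (x : DivisibleHull G) = (k : ℚ)⁻¹ • ((k • x : G) : DivisibleHull G) := by
    rw [eq_inv_smul_iff₀ (by exact_mod_cast hk)]
    exact (coe_nsmul k x).symm
  rw [e]
  exact Submodule.smul_mem _ _ h

variable [IsAlmostCompletelyDecomposable G]

theorem proj_mem (τ : D.criticalTypes) (v : DivisibleHull G) :
    D.proj τ v ∈ hull (D.component τ) := by
  unfold proj
  exact Subtype.property _

theorem sum_proj (v : DivisibleHull G) : ∑ τ, D.proj τ v = v := by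
  have htop : v ∈ ⨆ τ : D.criticalTypes, hull (D.component τ) := by
    rw [D.isInternal_hull.submodule_iSup_eq_top]; trivial
  induction htop using Submodule.iSup_induction' with
  | mem τ x hx => simp [D.proj_of_mem hx]
  | zero => simp
  | add x y _ _ hx hy => simp only [map_add, Finset.sum_add_distrib, hx, hy]

/-- On the regulator the rational projections agree with the coordinates of the direct sum of the
`Reg_τ G`, so no denominators appear. -/
theorem proj_coe_of_mem_regulator {x : G} (hx : x ∈ regulator G) (τ : D.criticalTypes) :
    ∃ a ∈ D.component τ, D.proj τ x = (a : DivisibleHull G) := by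
  obtain ⟨π, hπ⟩ := D.exists_component_coordinates
  refine ⟨π τ ⟨x, hx⟩, (π τ _).2, ?_⟩
  have h := hπ ⟨x, hx⟩
  have h' : (x : DivisibleHull G) = ∑ σ, ((π σ ⟨x, hx⟩ : G) : DivisibleHull G) := by
    have := congrArg (DivisibleHull.coeAddMonoidHom G) h
    rw [map_sum] at this
    exact this.symm
  rw [h', map_sum, Finset.sum_eq_single τ]
  · rw [D.proj_of_mem (D.mem_purification.1 (D.mem_purification_of_mem (π τ _).2)), if_pos rfl]
  · intro σ _ hσ
    rw [D.proj_of_mem (D.mem_purification.1 (D.mem_purification_of_mem (π σ _).2)), if_neg hσ.symm]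
  · simp

/-- An element of the regulator lying in the purification of `Reg_τ G` lies in `Reg_τ G`. -/
theorem mem_component_of_mem_regulator {x : G} (hx : x ∈ regulator G) {τ : D.criticalTypes}
    (h : x ∈ D.purification τ) : x ∈ D.component τ := by
  obtain ⟨a, ha, e⟩ := D.proj_coe_of_mem_regulator hx τ
  rw [D.proj_of_mem (D.mem_purification.1 h), if_pos rfl] at e
  have : IsAddTorsionFree G := IsAlmostCompletelyDecomposable.torsionFree
  rwa [DivisibleHull.coe_injective e]

variable {D}

/-! ### Purity of the components in a rigid group -/

/-- If `k G` lies in the regulator, multiplication by `k` embeds the purification into `Reg_τ G`,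
which in turn embeds into the purification. -/
theorem IsRigid.purification_isRankOne (h : D.IsRigid) (τ : D.criticalTypes) :
    IsRankOne (D.purification τ) := by
  have htf : IsAddTorsionFree G := IsAlmostCompletelyDecomposable.torsionFree
  have htf' : IsAddTorsionFree (D.purification τ) :=
    Function.Injective.isAddTorsionFree (D.purification τ).subtype Subtype.val_injective
  refine ⟨htf', le_antisymm ?_ ?_⟩
  · obtain ⟨k, hk, hkG⟩ := exists_nsmul_mem_regulator G
    let g : D.purification τ →+ D.component τ :=
      ((nsmulAddMonoidHom k).comp (D.purification τ).subtype).codRestrict (D.component τ)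
        fun x => D.mem_component_of_mem_regulator (hkG x) ((D.purification τ).nsmul_mem x.2 k)
    rw [← (h.hasType τ).1.2]
    refine LinearMap.rank_le_of_injective g.toIntLinearMap fun x y hxy => Subtype.ext ?_
    exact nsmul_right_injective hk.ne' (congrArg Subtype.val hxy)
  · rw [← (h.hasType τ).1.2]
    exact LinearMap.rank_le_of_injective
      (AddSubgroup.inclusion (K := D.purification τ) fun x => D.mem_purification_of_mem).toIntLinearMap
      (AddSubgroup.inclusion_injective (K := D.purification τ)
        fun x => D.mem_purification_of_mem)

theorem iSupIndep_purification : iSupIndep D.purification := by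
  have htf : IsAddTorsionFree G := IsAlmostCompletelyDecomposable.torsionFree
  have hi : iSupIndep fun τ : D.criticalTypes => hull (D.component τ) :=
    D.isInternal_hull.submodule_iSupIndep
  suffices h : iSupIndep fun τ => AddSubgroup.toIntSubmodule (D.purification τ) from
    (iSupIndep_map_orderIso_iff AddSubgroup.toIntSubmodule).1 h
  rw [iSupIndep_iff_finsetSum_eq_zero_imp_eq_zero] at hi ⊢
  intro s v hv hsum i his
  have hz := hi s (fun i => (v i : DivisibleHull G)) (fun j hj => hv j hj) ?_ i his
  · exact DivisibleHull.coe_injective (hz.trans (DivisibleHull.coeAddMonoidHom G).map_zero.symm)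
  · have := congrArg (DivisibleHull.coeAddMonoidHom G) hsum
    rw [map_sum, map_zero] at this
    exact this

theorem IsRigid.isCompletelyDecomposable_iSup_purification (h : D.IsRigid) :
    IsCompletelyDecomposable (⨆ τ, D.purification τ) := by
  let e := (Fintype.equivFin D.criticalTypes).symm
  exact ⟨_, D.purification ∘ e, fun i => h.purification_isRankOne (e i),
    iSupIndep_purification.comp e.injective, e.iSup_comp (g := D.purification)⟩

/-- The sum of the purifications contains all completely decomposable subgroups of finite
index. -/
theorem IsRigid.le_iSup_purification (h : D.IsRigid) {A' : AddSubgroup G}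
    (hA' : IsCompletelyDecomposable A') (hf : A'.FiniteIndex) :
    A' ≤ ⨆ τ, D.purification τ := by
  have htf : IsAddTorsionFree G := IsAlmostCompletelyDecomposable.torsionFree
  obtain ⟨n, B, hB⟩ := hA'
  rw [← hB.iSup_eq]
  refine iSup_le fun i x hx => ?_
  by_cases hx0 : x = 0
  · exact hx0 ▸ AddSubgroup.zero_mem _
  obtain ⟨k, hk, hkG⟩ := exists_nsmul_mem_regulator G
  obtain ⟨π, hπ⟩ := D.exists_component_coordinates
  obtain ⟨ρ, hρ⟩ := exists_coordinates hB.indep hB.iSup_eq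
  have hl : A'.index ≠ 0 := hf.index_ne_zero
  let toReg : G →+ regulator G := (nsmulAddMonoidHom k).codRestrict _ hkG
  let toA' : G →+ A' := (nsmulAddMonoidHom A'.index).codRestrict _ A'.nsmul_index_mem
  -- The composites `ψ τ ∘ φ τ` sum to multiplication by `A'.index * k` on `B i`. This forces some
  -- composite to be nonzero at `x`.
  let φ : ∀ τ : D.criticalTypes, B i →+ D.component τ :=
    fun τ => (π τ).comp (toReg.comp (B i).subtype)
  let ψ : ∀ τ : D.criticalTypes, D.component τ →+ B i :=
    fun τ => (ρ i).comp (toA'.comp (D.component τ).subtype)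
  have hφ : ∀ y : B i, ∑ τ, (φ τ y : G) = k • (y : G) := fun y => hπ (toReg y)
  -- The coordinates `ρ` are known only through their sum; independence of the `B j` shows that `ρ
  -- i` fixes `B i`.
  have hρi : ∀ y : A', (y : G) ∈ B i → (ρ i y : G) = y := by
    intro y hy
    have hB' : iSupIndep fun i => AddSubgroup.toIntSubmodule (B i) :=
      hB.indep.map_orderIso AddSubgroup.toIntSubmodule
    have h0 := (iSupIndep_iff_finsetSum_eq_zero_imp_eq_zero _).1 hB' Finset.univ
      (fun j => (ρ j y : G) - if j = i then (y : G) else 0) (fun j _ => ?_)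
      (by simp [Finset.sum_sub_distrib, hρ]) i (Finset.mem_univ i)
    · simpa [sub_eq_zero] using h0
    · refine (B j).sub_mem (ρ j y).2 ?_
      split_ifs with hj
      · exact hj ▸ hy
      · exact (B j).zero_mem
  have hne : ∃ τ, ψ τ (φ τ ⟨x, hx⟩) ≠ 0 := by
    by_contra! hc
    have hsum : ((ρ i) (toA' (k • x)) : G) = 0 := by
      have e1 : k • x = ∑ τ, (φ τ ⟨x, hx⟩ : G) := (hφ ⟨x, hx⟩).symm
      rw [e1, map_sum, map_sum]
      exact congrArg Subtype.val (Finset.sum_eq_zero fun τ _ => hc τ)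
    rw [hρi _ ((B i).nsmul_mem ((B i).nsmul_mem hx k) A'.index)] at hsum
    have hsum' : A'.index • k • x = 0 := hsum
    exact hx0 (by simpa [hl, hk.ne'] using hsum')
  obtain ⟨τ, hτ⟩ := hne
  -- `φ σ ∘ ψ τ` maps between components of different types, so it vanishes. Thus `φ σ` kills the
  -- nonzero element `ψ τ (φ τ x)` of the rank one group `B i`, hence all of `B i`.
  have hzero : ∀ σ, σ ≠ τ → φ σ ⟨x, hx⟩ = 0 := fun σ hσ =>
    have := (h.hasType σ).1.1
    (hB.rankOne i).eq_zero_of_apply_eq_zero (φ σ) hτ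
      (h.hom_eq_zero hσ.symm ((φ σ).comp (ψ τ)) _) _
  have hkx : k • x = φ τ ⟨x, hx⟩ := by
    rw [← show ∑ τ, (φ τ ⟨x, hx⟩ : G) = k • x from hφ ⟨x, hx⟩, Finset.sum_eq_single τ]
    · intro σ _ hσ
      rw [hzero σ hσ]
      rfl
    · simp
  refine AddSubgroup.mem_iSup_of_mem τ (D.mem_purification_of_nsmul_mem hk.ne' ?_)
  rw [hkx]
  exact (φ τ _).2

/-- In a rigid group the subgroups `Reg_τ G` are pure. -/
theorem IsRigid.mem_component_iff (h : D.IsRigid) {τ : D.criticalTypes} {x : G} :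
    x ∈ D.component τ ↔ (x : DivisibleHull G) ∈ hull (D.component τ) := by
  refine ⟨D.mem_purification_of_mem, fun hx => D.mem_component_of_mem_regulator ?_ hx⟩
  rw [regulator, AddSubgroup.mem_sInf]
  intro A' hA'
  have hle := h.le_iSup_purification hA'.1 hA'.2.1
  have hf := hA'.2.1
  -- A proper inclusion would make the sum of the purifications a completely decomposable subgroup
  -- of smaller index than `A'`.
  have heq : A' = ⨆ τ, D.purification τ := by
    by_contra hne
    exact absurd (AddSubgroup.index_strictAnti (lt_of_le_of_ne hle hne)) (not_lt.2
      (hA'.2.2 _ h.isCompletelyDecomposable_iSup_purification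
        (AddSubgroup.finiteIndex_of_le hle)))
  rw [heq]
  exact AddSubgroup.mem_iSup_of_mem τ hx

end RegulatorDecomposition

/-- Here `γ` is subtracted at every `τ`, not only on `T₀`: where `m τ = 1` the summand `m τ R τ` is
all of `R τ` and absorbs the difference. -/
theorem mem_kRing_iff {T : Type*} {R : T → Subring ℚ} {m : T → ℕ} {c : ∀ τ, R τ} :
    c ∈ kRing R m ↔ ∃ γ : ℤ, ∀ τ, ∃ y ∈ R τ, (c τ : ℚ) - γ = m τ * y := by
  constructor
  · rintro ⟨γ, y, rfl⟩
    refine ⟨γ, fun τ => ?_⟩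
    by_cases h : m τ = 1
    · exact ⟨y τ - γ, (R τ).sub_mem (y τ).2 (intCast_mem _ _), by simp [oneT₀, h]⟩
    · exact ⟨y τ, (y τ).2, by simp [oneT₀, h]⟩
  · rintro ⟨γ, h⟩
    choose y hy hc using h
    refine ⟨γ, fun τ => if m τ = 1 then c τ else ⟨y τ, hy τ⟩, ?_⟩
    funext τ
    by_cases h : m τ = 1
    · simp [oneT₀, h]
    · refine Subtype.ext ?_
      simp [oneT₀, h, ← hc]

namespace RegulatorDecomposition

variable {G : Type*} [AddCommGroup G] (D : RegulatorDecomposition G)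
  [IsAlmostCompletelyDecomposable G]

/-! ### Multiplications of the divisible hull -/

theorem proj_proj (τ σ : D.criticalTypes) (v : DivisibleHull G) :
    D.proj σ (D.proj τ v) = if σ = τ then D.proj τ v else 0 :=
  D.proj_of_mem (D.proj_mem τ v) σ

theorem mulBy_of_mem (c : D.criticalTypes → ℚ) {τ : D.criticalTypes} {v : DivisibleHull G}
    (hv : v ∈ hull (D.component τ)) : D.mulBy c v = c τ • v := by
  simp [mulBy, D.proj_of_mem hv]

theorem proj_mulBy (c : D.criticalTypes → ℚ) (σ : D.criticalTypes) (v : DivisibleHull G) :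
    D.proj σ (D.mulBy c v) = c σ • D.proj σ v := by
  simp [mulBy, map_sum, proj_proj]

theorem mulBy_mulBy (b c : D.criticalTypes → ℚ) (v : DivisibleHull G) :
    D.mulBy b (D.mulBy c v) = D.mulBy (fun τ => b τ * c τ) v := by
  change ∑ τ, b τ • D.proj τ (D.mulBy c v) = _
  simp only [proj_mulBy, smul_smul]
  rfl

theorem mulBy_one (v : DivisibleHull G) : D.mulBy (fun _ => 1) v = v := by
  simp [mulBy, D.sum_proj]

/-- The multiplication by a family of rational numbers as a homomorphism. -/
noncomputable def mulByHom (c : D.criticalTypes → ℚ) : DivisibleHull G →+ DivisibleHull G where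
  toFun := D.mulBy c
  map_zero' := by simp [mulBy]
  map_add' v w := by simp [mulBy, Finset.sum_add_distrib]

variable {D}

theorem coe_ne_zero {a : G} (ha : a ≠ 0) : (a : DivisibleHull G) ≠ 0 := by
  have : IsAddTorsionFree G := IsAlmostCompletelyDecomposable.torsionFree
  exact fun e => ha (DivisibleHull.coe_injective
    (e.trans (map_zero (DivisibleHull.coeAddMonoidHom G)).symm))

theorem IsRigid.eq_one_of_mulBy_eq (h : D.IsRigid) {c : D.criticalTypes → ℚ}
    (hc : ∀ x : G, D.mulBy c x = x) (τ : D.criticalTypes) : c τ = 1 := by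
  obtain ⟨a, ha, ha0⟩ := h.exists_ne_zero τ
  have e := hc a
  rw [D.mulBy_of_mem c (h.mem_component_iff.1 ha)] at e
  exact smul_left_injective ℚ (coe_ne_zero ha0) (by simpa using e)

/-- Multiplication by a rational number maps `Reg_τ G` into itself if and only if this number lies
in the subring of `ℚ` of type `τ`. -/
theorem IsRigid.mem_subring_iff (h : D.IsRigid) {τ : D.criticalTypes} {R : Subring ℚ}
    (hR : HasType R τ) (c : ℚ) :
    c ∈ R ↔ ∀ a ∈ D.component τ, ∃ b ∈ D.component τ,
      (b : DivisibleHull G) = c • (a : DivisibleHull G) := by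
  have htf : IsAddTorsionFree G := IsAlmostCompletelyDecomposable.torsionFree
  rw [(h.hasType τ).mem_subring_iff hR]
  constructor
  · intro hdiv a ha
    obtain ⟨y, hy⟩ := hdiv ⟨a, ha⟩
    have hy' : c.den • (y : G) = a := congrArg Subtype.val hy
    refine ⟨c.num • y, (D.component τ).zsmul_mem y.2 _, (coe_zsmul _ _).trans ?_⟩
    rw [← hy']
    refine Eq.trans ?_ (congrArg (c • ·) (coe_nsmul c.den (y : G)).symm)
    rw [smul_smul, Rat.mul_den_eq_num]
  · intro hmul a
    obtain ⟨b, hb, e⟩ := hmul a a.2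
    have hab : c.den • b = c.num • (a : G) := by
      refine DivisibleHull.coe_injective ((coe_nsmul _ _).trans (Eq.trans ?_ (coe_zsmul _ _).symm))
      refine (congrArg ((c.den : ℚ) • ·) e).trans ?_
      rw [smul_smul, Rat.den_mul_eq_num]
      rfl
    -- With `u * num + v * den = 1` and `den • b = num • a`, one gets `a = den • (u • b + v • a)`.
    have hz := Int.gcd_eq_gcd_ab c.num c.den
    rw [show Int.gcd c.num c.den = 1 from c.reduced] at hz
    refine ⟨(c.num.gcdA c.den) • ⟨b, hb⟩ + (c.num.gcdB c.den) • a, Subtype.ext ?_⟩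
    calc c.den • ((c.num.gcdA c.den) • b + (c.num.gcdB c.den) • (a : G))
        = (c.num.gcdA c.den) • (c.den • b) + (c.num.gcdB c.den) • (c.den • (a : G)) := by
          rw [smul_add, smul_comm c.den, smul_comm c.den]
      _ = (c.num * c.num.gcdA c.den + c.den * c.num.gcdB c.den) • (a : G) := by
          rw [hab, ← natCast_zsmul, smul_smul, smul_smul, ← add_smul, mul_comm, mul_comm (c.den : ℤ)]
      _ = a := by rw [← hz]; simp

theorem IsRigid.m_nsmul_proj (h : D.IsRigid) (d : G) (τ : D.criticalTypes) :
    ∃ a ∈ D.component τ, (a : DivisibleHull G) = (D.m d τ : ℚ) • D.proj τ d := by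
  have h0 := addOrderOf_nsmul_eq_zero (QuotientAddGroup.mk (D.proj τ (d : DivisibleHull G)) :
    DivisibleHull G ⧸ (regulator G).map (DivisibleHull.coeAddMonoidHom G))
  rw [← QuotientAddGroup.mk_nsmul, QuotientAddGroup.eq_zero_iff] at h0
  obtain ⟨a, -, e⟩ := h0
  have e' : (a : DivisibleHull G) = (D.m d τ : ℚ) • D.proj τ d :=
    e.trans (Nat.cast_smul_eq_nsmul ℚ _ _).symm
  exact ⟨a, h.mem_component_iff.2 (e' ▸ Submodule.smul_mem _ _ (D.proj_mem τ d)), e'⟩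

/-- An element `r` of the subring of `ℚ` of type `τ` with `r d_τ ∈ Reg_τ G` is divisible by
`m_τ`. -/
theorem exists_eq_m_mul {d : G} {τ : D.criticalTypes} {R : Subring ℚ} {r : ℚ} (hr : r ∈ R)
    {a : G} (ha : a ∈ D.component τ) (e : (a : DivisibleHull G) = r • D.proj τ d) :
    ∃ y ∈ R, r = D.m d τ * y := by
  -- Clearing the denominator of `r` gives `r.num • d_τ = r.den • a` in the regulator, so the order
  -- `m_τ` divides `r.num`. Dividing by `r.den` afterwards stays inside `R`.
  have hdvd : (D.m d τ : ℤ) ∣ r.num := by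
    rw [m, addOrderOf_dvd_iff_zsmul_eq_zero, ← QuotientAddGroup.mk_zsmul,
      QuotientAddGroup.eq_zero_iff]
    refine ⟨r.den • a, AddSubgroup.nsmul_mem _ (D.component_le_regulator τ ha) _,
      (coe_nsmul _ _).trans ?_⟩
    refine (congrArg ((r.den : ℚ) • ·) e).trans ?_
    rw [smul_smul, Rat.den_mul_eq_num]
    exact Int.cast_smul_eq_zsmul ℚ _ _
  obtain ⟨w, hw⟩ := hdvd
  refine ⟨w * (r.den : ℚ)⁻¹, R.mul_mem (intCast_mem R w) (Subring.inv_den_mem R hr), ?_⟩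
  nth_rewrite 1 [← Rat.num_div_den r]
  rw [hw]
  push_cast
  ring

/-! ### Endomorphisms -/

/-- After multiplication by `k`, the `σ`-coordinate of `f` on `Reg_τ G` is a homomorphism into
`Reg_σ G`, hence zero for `σ ≠ τ`; purity then removes the factor `k`. -/
theorem IsRigid.map_component (h : D.IsRigid) (f : G →+ G) {τ : D.criticalTypes} {a : G}
    (ha : a ∈ D.component τ) : f a ∈ D.component τ := by
  obtain ⟨k, hk, hkG⟩ := exists_nsmul_mem_regulator G
  obtain ⟨π, hπ⟩ := D.exists_component_coordinates
  let toReg : G →+ regulator G := (nsmulAddMonoidHom k).codRestrict _ hkG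
  let φ : ∀ σ : D.criticalTypes, D.component τ →+ D.component σ :=
    fun σ => (π σ).comp (toReg.comp (f.comp (D.component τ).subtype))
  have hka : k • f a = φ τ ⟨a, ha⟩ := by
    rw [← show ∑ σ, (φ σ ⟨a, ha⟩ : G) = k • f a from hπ (toReg (f a)), Finset.sum_eq_single τ]
    · intro σ _ hσ
      rw [h.hom_eq_zero hσ.symm]
      rfl
    · simp
  refine h.mem_component_iff.2 (D.mem_purification_of_nsmul_mem hk.ne' ?_)
  rw [hka]
  exact (φ τ _).2

theorem IsRigid.exists_eq_smul (h : D.IsRigid) (f : G →+ G) (τ : D.criticalTypes) :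
    ∃ c : ℚ, ∀ a ∈ D.component τ, (f a : DivisibleHull G) = c • (a : DivisibleHull G) := by
  obtain ⟨e, he, he0⟩ := h.exists_ne_zero τ
  have he0' : (⟨e, he⟩ : D.component τ) ≠ 0 := fun H => he0 (congrArg Subtype.val H)
  have key : ∀ a ∈ D.component τ, ∃ q : ℚ, (a : DivisibleHull G) = q • (e : DivisibleHull G) ∧
      (f a : DivisibleHull G) = q • (f e : DivisibleHull G) := by
    intro a ha
    obtain ⟨s, t, hs, hst⟩ := (h.hasType τ).1.exists_zsmul_eq he0' ⟨a, ha⟩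
    have hst' : s • a = t • e := congrArg Subtype.val hst
    have hs' : (s : ℚ) ≠ 0 := by exact_mod_cast hs
    have main : ∀ x y : G, s • x = t • y →
        (x : DivisibleHull G) = ((s : ℚ)⁻¹ * t) • (y : DivisibleHull G) := by
      intro x y hxy
      rw [mul_smul, eq_inv_smul_iff₀ hs']
      exact (coe_zsmul s x).symm.trans
        ((congrArg (DivisibleHull.coeAddMonoidHom G) hxy).trans (coe_zsmul t y))
    exact ⟨_, main a e hst', main (f a) (f e) (by rw [← map_zsmul, hst', map_zsmul])⟩
  obtain ⟨s, t, hs, hst⟩ := (h.hasType τ).1.exists_zsmul_eq he0' ⟨f e, h.map_component f he⟩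
  have hst' : s • f e = t • e := congrArg Subtype.val hst
  have hs' : (s : ℚ) ≠ 0 := by exact_mod_cast hs
  have hfe : (f e : DivisibleHull G) = ((s : ℚ)⁻¹ * t) • (e : DivisibleHull G) := by
    rw [mul_smul, eq_inv_smul_iff₀ hs']
    exact (coe_zsmul s (f e)).symm.trans
      ((congrArg (DivisibleHull.coeAddMonoidHom G) hst').trans (coe_zsmul t e))
  refine ⟨(s : ℚ)⁻¹ * t, fun a ha => ?_⟩
  obtain ⟨q, h1, h2⟩ := key a ha
  rw [h2, h1, hfe, smul_comm]

theorem IsRigid.exists_mem_subring (h : D.IsRigid) {R : D.criticalTypes → Subring ℚ}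
    (hR : ∀ τ, HasType (R τ) τ) (f : G →+ G) :
    ∃ c : ∀ τ, R τ, ∀ x : G, (f x : DivisibleHull G) = D.mulBy (fun τ => (c τ : ℚ)) x := by
  choose c hc using h.exists_eq_smul f
  have hcR : ∀ τ, c τ ∈ R τ := fun τ => (h.mem_subring_iff (hR τ) _).2
    fun a ha => ⟨f a, h.map_component f ha, hc τ a ha⟩
  refine ⟨fun τ => ⟨c τ, hcR τ⟩, fun x => ?_⟩
  change (f x : DivisibleHull G) = D.mulBy c x
  let ι := DivisibleHull.coeAddMonoidHom G
  -- Both maps agree on each component, hence on the regulator, which contains `k G`; the factor `k`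
  -- cancels in the divisible hull.
  have hreg : regulator G ≤ (ι.comp f).eqLocus ((D.mulByHom c).comp ι) := by
    rw [← D.iSup_component]
    exact iSup_le fun τ a ha =>
      (hc τ a ha).trans (D.mulBy_of_mem c (h.mem_component_iff.1 ha)).symm
  obtain ⟨k, hk, hkG⟩ := exists_nsmul_mem_regulator G
  have e : (ι.comp f) (k • x) = ((D.mulByHom c).comp ι) (k • x) := hreg (hkG x)
  rw [map_nsmul, map_nsmul, ← Nat.cast_smul_eq_nsmul ℚ, ← Nat.cast_smul_eq_nsmul ℚ] at e
  exact smul_right_injective _ (by exact_mod_cast hk.ne' : (k : ℚ) ≠ 0) e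

theorem IsRigid.exists_mem_kRing (h : D.IsRigid) {R : D.criticalTypes → Subring ℚ}
    (hR : ∀ τ, HasType (R τ) τ) {d : G}
    (hd : AddSubgroup.zmultiples (d : G ⧸ regulator G) = ⊤) (f : G →+ G) :
    ∃ c ∈ kRing R (D.m d), ∀ x : G,
      (f x : DivisibleHull G) = D.mulBy (fun τ => (c τ : ℚ)) x := by
  obtain ⟨c, hc⟩ := h.exists_mem_subring hR f
  refine ⟨c, mem_kRing_iff.2 ?_, hc⟩
  obtain ⟨γ, hγ⟩ := exists_sub_zsmul_mem hd (f d)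
  refine ⟨γ, fun τ => ?_⟩
  obtain ⟨a, ha, e⟩ := D.proj_coe_of_mem_regulator hγ τ
  refine exists_eq_m_mul ((R τ).sub_mem (c τ).2 (intCast_mem _ _)) ha ?_
  rw [← e, show ((f d - γ • d : G) : DivisibleHull G) = f d - (γ : ℚ) • (d : DivisibleHull G) from
    ((DivisibleHull.coeAddMonoidHom G).map_sub _ _).trans (congrArg _ (coe_zsmul γ d)),
    hc d, map_sub, proj_mulBy, map_smul, sub_smul]

/-! ### From elements of `K_G` to endomorphisms -/

/-- As `G` is generated by the regulator and `d`, it suffices to treat these two: the regulator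
needs only `c τ ∈ R τ`, while `d` needs the congruences modulo `m_τ`. -/
theorem IsRigid.mulBy_mem_range (h : D.IsRigid) {R : D.criticalTypes → Subring ℚ}
    (hR : ∀ τ, HasType (R τ) τ) {d : G}
    (hd : AddSubgroup.zmultiples (d : G ⧸ regulator G) = ⊤) {c : ∀ τ, R τ}
    (hc : c ∈ kRing R (D.m d)) (x : G) :
    D.mulBy (fun τ => (c τ : ℚ)) x ∈ (DivisibleHull.coeAddMonoidHom G).range := by
  let ι := DivisibleHull.coeAddMonoidHom G
  have hreg : ∀ a ∈ regulator G, D.mulBy (fun τ => (c τ : ℚ)) a ∈ ι.range := by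
    intro a ha
    refine AddSubgroup.sum_mem _ fun τ _ => ?_
    obtain ⟨b, hb, e⟩ := D.proj_coe_of_mem_regulator ha τ
    obtain ⟨z, -, hz⟩ := (h.mem_subring_iff (hR τ) (c τ)).1 (c τ).2 b hb
    exact ⟨z, hz.trans (congrArg _ e.symm)⟩
  have hdmem : D.mulBy (fun τ => (c τ : ℚ)) d ∈ ι.range := by
    obtain ⟨γ, hγ⟩ := mem_kRing_iff.1 hc
    have e : D.mulBy (fun τ => (c τ : ℚ)) d =
        γ • ι d + ∑ τ, ((c τ : ℚ) - γ) • D.proj τ d := by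
      simp only [sub_smul, Finset.sum_sub_distrib]
      rw [← Finset.smul_sum, D.sum_proj, ← Int.cast_smul_eq_zsmul ℚ]
      exact (add_sub_cancel _ _).symm
    rw [e]
    refine AddSubgroup.add_mem _ (AddSubgroup.zsmul_mem ι.range ⟨d, rfl⟩ _)
      (AddSubgroup.sum_mem _ fun τ _ => ?_)
    obtain ⟨y, hy, hcy⟩ := hγ τ
    obtain ⟨b, hb, e'⟩ := h.m_nsmul_proj d τ
    obtain ⟨z, -, hz⟩ := (h.mem_subring_iff (hR τ) y).1 hy b hb
    refine ⟨z, hz.trans ?_⟩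
    rw [e', smul_smul, hcy, mul_comm]
  obtain ⟨γ, hγ⟩ := exists_sub_zsmul_mem hd x
  have e : D.mulBy (fun τ => (c τ : ℚ)) x = D.mulBy (fun τ => (c τ : ℚ)) (x - γ • d : G) +
      γ • D.mulBy (fun τ => (c τ : ℚ)) d := by
    have e1 := map_add ((D.mulByHom fun τ => (c τ : ℚ)).comp ι) (x - γ • d) (γ • d)
    rw [sub_add_cancel, map_zsmul] at e1
    exact e1
  rw [e]
  exact AddSubgroup.add_mem _ (hreg _ hγ) (AddSubgroup.zsmul_mem _ hdmem _)

theorem IsRigid.exists_endomorphism (h : D.IsRigid) {R : D.criticalTypes → Subring ℚ}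
    (hR : ∀ τ, HasType (R τ) τ) {d : G}
    (hd : AddSubgroup.zmultiples (d : G ⧸ regulator G) = ⊤) {c : ∀ τ, R τ}
    (hc : c ∈ kRing R (D.m d)) :
    ∃ f : G →+ G, ∀ x : G, (f x : DivisibleHull G) = D.mulBy (fun τ => (c τ : ℚ)) x := by
  have htf : IsAddTorsionFree G := IsAlmostCompletelyDecomposable.torsionFree
  have hinj : Function.Injective (DivisibleHull.coeAddMonoidHom G) := DivisibleHull.coe_injective
  let e := AddMonoidHom.ofInjective hinj
  let g : G →+ (DivisibleHull.coeAddMonoidHom G).range :=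
    ((D.mulByHom fun τ => (c τ : ℚ)).comp (DivisibleHull.coeAddMonoidHom G)).codRestrict _
      (h.mulBy_mem_range hR hd hc)
  exact ⟨e.symm.toAddMonoidHom.comp g,
    fun x => congrArg Subtype.val (e.apply_symm_apply (g x))⟩

end RegulatorDecomposition
end ACD

/-- Let `G` be a rigid almost completely decomposable group of ring type with cyclic regulator
quotient `G / Reg G`, generated by the coset of `d`. The endomorphisms (automorphisms) of `G` are
exactly the multiplications by elements of the ring `K_G` (by units of `K_G`). -/
theorem lemma2p3 {G : Type*} [AddCommGroup G] [ACD.IsAlmostCompletelyDecomposable G]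
    (D : ACD.RegulatorDecomposition G) (hrigid : D.IsRigid) (hring : D.IsOfRingType)
    (d : G) (hd : AddSubgroup.zmultiples (d : G ⧸ ACD.regulator G) = ⊤)
    (R : D.criticalTypes → Subring ℚ) (hR : ∀ τ, ACD.HasType (R τ) τ) :
    (∀ f : G →+ G, ∃ c ∈ ACD.kRing R (D.m d), ∀ x : G,
      (f x : DivisibleHull G) = D.mulBy (fun τ => (c τ : ℚ)) x) ∧
    (∀ f : G ≃+ G, ∃ c : (ACD.kRing R (D.m d))ˣ, ∀ x : G,
      (f x : DivisibleHull G) = D.mulBy (fun τ => ((c : ACD.kRing R (D.m d)).1 τ : ℚ)) x) ∧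
    (∀ c ∈ ACD.kRing R (D.m d), ∃ f : G →+ G, ∀ x : G,
      (f x : DivisibleHull G) = D.mulBy (fun τ => (c τ : ℚ)) x) ∧
    (∀ c : (ACD.kRing R (D.m d))ˣ, ∃ f : G ≃+ G, ∀ x : G,
      (f x : DivisibleHull G) = D.mulBy (fun τ => ((c : ACD.kRing R (D.m d)).1 τ : ℚ)) x) := by
  have htf : IsAddTorsionFree G := ACD.IsAlmostCompletelyDecomposable.torsionFree
  refine ⟨hrigid.exists_mem_kRing hR hd, fun f => ?_,
    fun c hc => hrigid.exists_endomorphism hR hd hc, fun c => ?_⟩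
  · obtain ⟨b, hb, hfb⟩ := hrigid.exists_mem_kRing hR hd f.toAddMonoidHom
    obtain ⟨c, hc, hfc⟩ := hrigid.exists_mem_kRing hR hd f.symm.toAddMonoidHom
    -- The inverse of `b` must be found inside `K_G`. It is the multiplier of `f.symm`, since `b *
    -- c` acts as the identity on `G` and each component contains a nonzero element.
    have hbc : b * c = 1 := by
      funext τ
      refine Subtype.ext (hrigid.eq_one_of_mulBy_eq (c := fun τ => (b τ : ℚ) * c τ) (fun x => ?_) τ)
      rw [← D.mulBy_mulBy, ← hfc, ← hfb]
      exact congrArg _ (f.apply_symm_apply x)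
    exact ⟨⟨⟨b, hb⟩, ⟨c, hc⟩, Subtype.ext hbc, Subtype.ext ((mul_comm c b).trans hbc)⟩, hfb⟩
  · obtain ⟨f, hf⟩ := hrigid.exists_endomorphism hR hd (c : ACD.kRing R (D.m d)).2
    obtain ⟨g, hg⟩ := hrigid.exists_endomorphism hR hd ((c⁻¹ :) : ACD.kRing R (D.m d)).2
    have hcomp : ∀ (u v : ACD.kRing R (D.m d)), u * v = 1 → ∀ x : DivisibleHull G,
        D.mulBy (fun τ => (u.1 τ : ℚ)) (D.mulBy (fun τ => (v.1 τ : ℚ)) x) = x := by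
      intro u v huv x
      rw [D.mulBy_mulBy]
      have e : (fun τ => (u.1 τ : ℚ) * v.1 τ) = fun _ => 1 := by
        funext τ
        exact congrArg (fun w : ACD.kRing R (D.m d) => (w.1 τ : ℚ)) huv
      rw [e, D.mulBy_one]
    refine ⟨{ f with
      invFun := g
      left_inv := fun x => DivisibleHull.coe_injective ?_
      right_inv := fun x => DivisibleHull.coe_injective ?_ }, hf⟩
    · exact (hg (f x)).trans (by rw [hf, hcomp _ _ c.inv_mul])
    · exact (hf (g x)).trans (by rw [hg, hcomp _ _ c.mul_inv])
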